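/- Let $M$ be a connected $2$-manifold (a connected Hausdorff space in which every point has an open neighbourhood homeomorphic to an open subset of the closed half-plane, so $M$ may have boundary and need not be compact). Let $\theta\colon[0,\infty)\to M$ be a continuous injection, let $0\le t_1<t_2<\cdots$, and put $p_i=\theta(t_i)$. Let $F(M,n)\subseteq M^n$ be the space of $n$-tuples of pairwise distinct points, and let $B_n(M)=\pi_1(F(M,n)/\Sigma_n)$ be the $n$-strand braid group of $M$, based at the class of $(p_1,\dots,p_n)$. A braid $\beta\in B_n(M)$ lifts to a path $(\lambda_1,\dots,\lambda_n)$ in $F(M,n)$ with $\lambda_j(0)=p_j$ and $\lambda_j(1)=p_{\sigma(j)}$ for a permutation $\sigma$. For $1\le i\le n$ let $d_i(\beta)\in B_{n-1}(M)$ be the class of $$L_i*(\lambda_1,\dots,\lambda_{i-1},\lambda_{i+1},\dots,\lambda_n)*L_{\sigma(i)}^{-1},$$ where $L_k$ is the path of $n-1$ distinct points which moves, linearly in the parameter along $\theta$ and preserving the order, from $\{p_1,\dots,p_{n-1}\}$ to $\{p_1,\dots,p_n\}\setminus\{p_k\}$. A braid is called Brunnian if $d_i(\beta)=1$ for all $1\le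 i\le n$; the Brunnian braids form a subgroup $\mathrm{Brun}_n(M)$ of $B_n(M)$. Then $\mathrm{Brun}_2(M)$ is a normal subgroup of $B_2(M)$ if and only if $\pi_1(M)=\{1\}$. -/

import Mathlib

open scoped NNReal

noncomputable section

namespace SurfaceBraid

/-! ### Configuration spaces -/

section Configuration

variable {M : Type*} {n : ℕ}

/-- The ordered configuration space `F(M, n)`: `n`-tuples of pairwise distinct points of `M`, with
the subspace topology of `M ^ n`. -/
abbrev Conf (M : Type*) (n : ℕ) : Type _ :=
  {x : Fin n → M // Function.Injective x}

/-- The symmetric group permutes the coordinates: `(g • x) i = x (g⁻¹ i)`. -/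
instance : MulAction (Equiv.Perm (Fin n)) (Conf M n) where
  smul g x := ⟨fun i => x.1 (g⁻¹ i), x.2.comp (Equiv.injective _)⟩
  one_smul _ := rfl
  mul_smul g h x := by
    apply Subtype.ext
    funext i
    change x.1 ((g * h)⁻¹ i) = x.1 (h⁻¹ (g⁻¹ i))
    rw [mul_inv_rev, Equiv.Perm.mul_apply]

theorem smul_coe (g : Equiv.Perm (Fin n)) (x : Conf M n) (i : Fin n) :
    (g • x).1 i = x.1 (g⁻¹ i) := rfl

/-- The unordered configuration space `F(M, n) / Σ_n`, with the quotient topology. -/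
abbrev UConf (M : Type*) (n : ℕ) : Type _ :=
  MulAction.orbitRel.Quotient (Equiv.Perm (Fin n)) (Conf M n)

variable [TopologicalSpace M]

/-- The projection `F(M, n) → F(M, n) / Σ_n`. -/
def proj : C(Conf M n, UConf M n) :=
  ⟨Quotient.mk _, continuous_quotient_mk'⟩

theorem proj_eq_iff {x y : Conf M n} :
    proj x = proj y ↔ x ∈ MulAction.orbit (Equiv.Perm (Fin n)) y :=
  Quotient.eq.trans MulAction.orbitRel_apply

/-- Two ordered configurations with the same underlying set define the same unordered one. -/
theorem proj_eq_of_range_eq {x y : Conf M n} (h : Set.range x.1 = Set.range y.1) :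
    proj x = proj y := by
  have key : ∀ i, ∃ j, x.1 j = y.1 i := fun i => by
    have : y.1 i ∈ Set.range x.1 := h.symm ▸ Set.mem_range_self i
    exact this
  choose f hf using key
  have hinj : Function.Injective f := fun a b hab => y.2 (by rw [← hf a, ← hf b, hab])
  refine proj_eq_iff.2 ⟨Equiv.ofBijective f (Finite.injective_iff_bijective.1 hinj), ?_⟩
  apply Subtype.ext
  funext i
  rw [smul_coe, ← hf]
  exact congrArg x.1 (Equiv.apply_symm_apply
    (Equiv.ofBijective f (Finite.injective_iff_bijective.1 hinj)) i)

/-- On a Hausdorff space, `F(M, n) → F(M, n) / Σ_n` is the covering map given by the free action of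
the symmetric group. -/
theorem isQuotientCoveringMap_proj [T2Space M] :
    IsQuotientCoveringMap (proj : Conf M n → UConf M n) (Equiv.Perm (Fin n)) where
  surjective := Quotient.mk_surjective
  eq_coinduced := rfl
  continuous_const_smul g := by
    refine Continuous.subtype_mk ?_ _
    exact continuous_pi fun i => (continuous_apply _).comp continuous_subtype_val
  apply_eq_iff_mem_orbit := proj_eq_iff
  disjoint e := by
    have hsep : ∃ V : Fin n → Set M, (∀ i, e.1 i ∈ V i ∧ IsOpen (V i)) ∧
        Set.univ.PairwiseDisjoint V := by
      obtain ⟨W, hW, hd⟩ := (Set.finite_range e.1).t2_separation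
      refine ⟨fun i => W (e.1 i), fun i => hW _, fun i _ j _ hij => ?_⟩
      exact hd (Set.mem_range_self i) (Set.mem_range_self j) (e.2.ne hij)
    obtain ⟨V, hV, hd⟩ := hsep
    refine ⟨{x | ∀ i, x.1 i ∈ V i}, ?_, fun g => ?_⟩
    · refine IsOpen.mem_nhds ?_ fun i => (hV i).1
      rw [Set.ofPred_forall]
      exact isOpen_iInter_of_finite fun i =>
        (hV i).2.preimage ((continuous_apply i).comp continuous_subtype_val)
    · rintro ⟨_, ⟨x, hx, rfl⟩, hy⟩
      have hs : g⁻¹ = 1 := by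
        ext i
        by_contra hne
        refine Set.disjoint_left.1 (hd (Set.mem_univ (g⁻¹ i)) (Set.mem_univ i) ?_)
          (hx (g⁻¹ i)) (hy i)
        intro h
        exact hne (by rw [h]; rfl)
      exact inv_eq_one.1 hs

theorem proj_smul (g : Equiv.Perm (Fin n)) (x : Conf M n) : proj (g • x) = proj x :=
  proj_eq_iff.2 ⟨g, rfl⟩

theorem isCoveringMap_proj [T2Space M] : IsCoveringMap (proj : Conf M n → UConf M n) :=
  isQuotientCoveringMap_proj.isCoveringMap

/-- The coordinate projection `F(M, n + 1) → F(M, n)` that omits the `i`-th point. -/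
def forget (i : Fin (n + 1)) : C(Conf M (n + 1), Conf M n) :=
  ⟨fun x => ⟨fun j => x.1 (i.succAbove j), x.2.comp Fin.succAbove_right_injective⟩,
    Continuous.subtype_mk (f := fun (x : Conf M (n + 1)) j => x.1 (i.succAbove j))
      (continuous_pi fun j => (continuous_apply (i.succAbove j)).comp continuous_subtype_val) _⟩

theorem proj_forget_eq {x y : Conf M (n + 1)} {τ : Equiv.Perm (Fin (n + 1))}
    (h : ∀ j, y.1 j = x.1 (τ j)) (i : Fin (n + 1)) :
    proj (forget i y) = proj (forget (τ i) x) := by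
  apply proj_eq_of_range_eq
  change Set.range (y.1 ∘ i.succAbove) = Set.range (x.1 ∘ (τ i).succAbove)
  have : y.1 = x.1 ∘ τ := funext h
  rw [Set.range_comp, Set.range_comp, Fin.range_succAbove, Fin.range_succAbove, this,
    Set.image_comp, Set.image_compl_eq τ.bijective, Set.image_singleton]

end Configuration

/-! ### Homotopy classes of paths -/

theorem map_trans {X Y : Type*} [TopologicalSpace X] [TopologicalSpace Y] {a b c : X}
    (P : Path.Homotopic.Quotient a b) (Q : Path.Homotopic.Quotient b c) (f : C(X, Y)) :
    (P.trans Q).map f = (P.map f).trans (Q.map f) := by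
  induction P using Path.Homotopic.Quotient.ind with | mk P =>
  induction Q using Path.Homotopic.Quotient.ind with | mk Q =>
  rw [← Path.Homotopic.Quotient.mk_trans, ← Path.Homotopic.Quotient.mk_map,
    ← Path.Homotopic.Quotient.mk_map, ← Path.Homotopic.Quotient.mk_map,
    ← Path.Homotopic.Quotient.mk_trans, Path.map_trans]

theorem cast_trans_cast {X : Type*} [TopologicalSpace X] {a b c a' b' c' : X}
    (P : Path.Homotopic.Quotient a b) (Q : Path.Homotopic.Quotient b c)
    (ha : a' = a) (hb : b' = b) (hc : c' = c) :
    (P.cast ha hb).trans (Q.cast hb hc) = (P.trans Q).cast ha hc := by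
  subst ha hb hc
  simp

theorem conj_trans {X : Type*} [TopologicalSpace X] {o a b b' c c' d : X}
    (L : Path.Homotopic.Quotient o a) (P : Path.Homotopic.Quotient a b)
    (K : Path.Homotopic.Quotient o b') (Q : Path.Homotopic.Quotient b' c')
    (N : Path.Homotopic.Quotient o d) (h : b = b') (h' : c = c') (h'' : c' = d) :
    (L.trans (P.trans (K.symm.cast h rfl))).trans (K.trans (Q.trans (N.symm.cast h'' rfl))) =
      L.trans ((P.trans (Q.cast h h')).trans (N.symm.cast (h'.trans h'') rfl)) := by
  subst h h' h''
  have h1 : K.symm.trans (K.trans (Q.trans N.symm)) = Q.trans N.symm := by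
    rw [← Path.Homotopic.Quotient.trans_assoc, Path.Homotopic.Quotient.symm_trans,
      Path.Homotopic.Quotient.refl_trans]
  simp only [Path.Homotopic.Quotient.cast_rfl_rfl, Path.Homotopic.Quotient.trans_assoc, h1]

/-! ### Simple curves, basepoints and braid groups -/

/-- A simple (half-open) curve in `M`: a continuous injection `[0, ∞) → M`. -/
structure SimpleCurve (M : Type*) [TopologicalSpace M] where
  toFun : ℝ≥0 → M
  continuous_toFun : Continuous toFun
  injective_toFun : Function.Injective toFun

section Braid

variable {M : Type*} [TopologicalSpace M] (θ : SimpleCurve M) (t : ℕ ↪o ℝ≥0)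

/-- The basepoint `(θ t₀, …, θ tₙ₋₁)` of `F(M, n)`, which is well-ordered with respect to `θ`, as
`t₀ < t₁ < ⋯`. -/
def base (n : ℕ) : Conf M n :=
  ⟨fun i => θ.toFun (t i), fun _ _ h => Fin.ext (t.injective (θ.injective_toFun h))⟩

/-- The braid group `B_n(M) = π₁(F(M, n) / Σ_n)`. -/
abbrev BraidGroup (n : ℕ) : Type _ :=
  FundamentalGroup (UConf M n) (proj (base θ t n))

/-- The `θ`-linear braid from `(θ a₀, …, θ aₙ₋₁)` to `(θ b₀, …, θ bₙ₋₁)`, for increasing `a`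
and `b`. -/
def linearBraid {n : ℕ} {a b : Fin n → ℝ≥0} (ha : StrictMono a) (hb : StrictMono b)
    {x y : Conf M n} (hx : ∀ j, x.1 j = θ.toFun (a j)) (hy : ∀ j, y.1 j = θ.toFun (b j)) :
    Path x y where
  toFun s := ⟨fun j => θ.toFun
      (unitInterval.toNNReal (unitInterval.symm s) * a j + unitInterval.toNNReal s * b j), by
    refine θ.injective_toFun.comp (StrictMono.injective fun j k hjk => ?_)
    have h1 := ha hjk
    have h2 := hb hjk
    rw [← NNReal.coe_lt_coe] at h1 h2 ⊢
    push_cast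
    have h3 := s.2.1
    have h4 := s.2.2
    simp only [unitInterval.coe_toNNReal, unitInterval.coe_symm_eq]
    rcases h3.lt_or_eq with h | h
    · nlinarith
    · rw [← h]; linarith⟩
  continuous_toFun := by
    refine Continuous.subtype_mk (continuous_pi fun j => θ.continuous_toFun.comp ?_) _
    have h1 := unitInterval.toNNReal_continuous
    have h2 := h1.comp unitInterval.continuous_symm
    exact (h2.mul continuous_const).add (h1.mul continuous_const)
  source' := by
    apply Subtype.ext
    funext j
    rw [hx]
    simp
  target' := by
    apply Subtype.ext
    funext j
    rw [hy]
    simp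

variable {n : ℕ}

/-- The `n`-strand `θ`-linear braid from `{p_0, …, p_{n-1}}` to `{p_0, …, p_n} ∖ {p_i}`. -/
def gap (i : Fin (n + 1)) : Path (base θ t n) (forget i (base θ t (n + 1))) :=
  linearBraid θ (a := fun j => t j) (b := fun j => t (i.succAbove j))
    (fun _ _ h => t.strictMono h) (fun _ _ h => t.strictMono (Fin.strictMono_succAbove i h))
    (fun _ => rfl) (fun _ => rfl)

/-- The class of `gap` in `F(M, n) / Σ_n`. -/
def gapClass (i : Fin (n + 1)) :
    Path.Homotopic.Quotient (proj (base θ t n)) (proj (forget i (base θ t (n + 1)))) :=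
  (Path.Homotopic.Quotient.mk (gap θ t i)).map proj

/-- Removal of the `i`-th strand of the geometric braid given by a path
`Γ = (λ_0, …, λ_n)` in `F(M, n + 1)` with `λ_j(0) = p_j` and `λ_j(1) = p_{τ j}`: the class of
`L * (λ_0, …, λ_{i-1}, λ_{i+1}, …, λ_n) * L'`. Here `L` is the `θ`-linear braid from
`{p_0, …, p_{n-1}}` to `{p_0, …, p_n} ∖ {p_i}`, and `L'` is the `θ`-linear braid from
`{p_0, …, p_n} ∖ {p_{τ i}}` to `{p_0, …, p_{n-1}}`, which in `F(M, n) / Σ_n` is the reverse of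
`gap (τ i)`. -/
def removeGeom {q : Conf M (n + 1)} (Γ : Path.Homotopic.Quotient (base θ t (n + 1)) q)
    (τ : Equiv.Perm (Fin (n + 1))) (hq : ∀ j, q.1 j = (base θ t (n + 1)).1 (τ j))
    (i : Fin (n + 1)) : BraidGroup θ t n :=
  FundamentalGroup.fromPath <|
    (gapClass θ t i).trans <|
      ((Γ.map (forget i)).map proj).trans <|
        (gapClass θ t (τ i)).symm.cast (proj_forget_eq hq i) rfl

variable [T2Space M]

/-- The basepoint as a point of the fibre of the covering `F(M, n) → F(M, n) / Σ_n`. -/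
def baseFiber (n : ℕ) : (proj : Conf M n → UConf M n) ⁻¹' {proj (base θ t n)} :=
  ⟨base θ t n, rfl⟩

/-- The endpoint of the lift of a braid to `F(M, n)` starting at the basepoint. -/
def endpoint (β : BraidGroup θ t n) : (proj : Conf M n → UConf M n) ⁻¹' {proj (base θ t n)} :=
  isCoveringMap_proj.monodromy (FundamentalGroup.toPath β) (baseFiber θ t n)

/-- The lift `(λ_0, …, λ_{n-1})` of a braid to `F(M, n)` starting at the basepoint, as a homotopy
class of paths relative to the endpoints. -/
def strands (β : BraidGroup θ t n) :
    Path.Homotopic.Quotient (base θ t n) (endpoint θ t β).1 :=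
  isCoveringMap_proj.liftPathQuotient (FundamentalGroup.toPath β) (baseFiber θ t n)

/-- The permutation of a braid: `λ_j(1) = p_{strandPerm β j}`. -/
def strandPerm (β : BraidGroup θ t n) : Equiv.Perm (Fin n) :=
  (isQuotientCoveringMap_proj.fiberEquivGroup (baseFiber θ t n) (endpoint θ t β))⁻¹

theorem proj_endpoint (β : BraidGroup θ t n) :
    proj (endpoint θ t β).1 = proj (base θ t n) :=
  (endpoint θ t β).2

theorem endpoint_apply (β : BraidGroup θ t n) (j : Fin n) :
    (endpoint θ t β).1.1 j = (base θ t n).1 (strandPerm θ t β j) := by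
  have h := isQuotientCoveringMap_proj.fiberEquivGroup_smul_self (baseFiber θ t n)
    (e' := endpoint θ t β)
  rw [← h, smul_coe]
  rfl

/-- The operation `d_i : B_{n+1}(M) → B_n(M)` of removing the `i`-th strand. -/
def removeStrand (i : Fin (n + 1)) (β : BraidGroup θ t (n + 1)) : BraidGroup θ t n :=
  removeGeom θ t (strands θ t β) (strandPerm θ t β) (endpoint_apply θ t β) i

/-- `removeStrand` may be computed from any lift. -/
theorem removeStrand_eq_removeGeom (β : BraidGroup θ t (n + 1)) {q : Conf M (n + 1)}
    (Γ : Path.Homotopic.Quotient (base θ t (n + 1)) q)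
    (hp : proj q = proj (base θ t (n + 1)))
    (hΓ : Γ.map proj = (FundamentalGroup.toPath β).cast rfl hp)
    (τ : Equiv.Perm (Fin (n + 1))) (hq : ∀ j, q.1 j = (base θ t (n + 1)).1 (τ j))
    (i : Fin (n + 1)) :
    removeStrand θ t i β = removeGeom θ t Γ τ hq i := by
  have h1 : (endpoint θ t β).1 = q := by
    have := isCoveringMap_proj.monodromy_eq_of_map_eq (γ := FundamentalGroup.toPath β)
      (ex := baseFiber θ t (n + 1)) (ey := ⟨q, hp⟩) Γ hΓ
    exact congrArg Subtype.val this
  subst h1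
  have h2 : strandPerm θ t β = τ := by
    ext1 j
    exact (base θ t (n + 1)).2 ((endpoint_apply θ t β j).symm.trans (hq j))
  subst h2
  have h3 : strands θ t β = Γ := by
    apply isCoveringMap_proj.injective_path_homotopic_map
    exact (isCoveringMap_proj.map_liftPathQuotient _ _).trans hΓ.symm
  subst h3
  rfl

/-- The product on `FundamentalGroup` is concatenation in the reverse order: `β' * β` runs through
`β` first. -/
theorem removeStrand_mul (β β' : BraidGroup θ t (n + 1)) (i : Fin (n + 1)) :
    removeStrand θ t i (β' * β) =
      removeStrand θ t (strandPerm θ t β i) β' * removeStrand θ t i β := by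
  obtain ⟨Γ, hΓ⟩ := Path.Homotopic.Quotient.mk_surjective (strands θ t β)
  obtain ⟨Γ', hΓ'⟩ := Path.Homotopic.Quotient.mk_surjective (strands θ t β')
  set τ := strandPerm θ t β with hτ
  have hc : Continuous fun x : Conf M (n + 1) => τ⁻¹ • x :=
    isQuotientCoveringMap_proj.continuous_const_smul τ⁻¹
  have he : τ⁻¹ • base θ t (n + 1) = (endpoint θ t β).1 := by
    apply Subtype.ext
    funext j
    rw [smul_coe, inv_inv, endpoint_apply]
  let Δ : Path (endpoint θ t β).1 (τ⁻¹ • (endpoint θ t β').1) :=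
    (Γ'.map hc).cast he.symm rfl
  have hp : proj (τ⁻¹ • (endpoint θ t β').1) = proj (base θ t (n + 1)) :=
    (proj_smul _ _).trans (proj_endpoint θ t β')
  have hβ := isCoveringMap_proj.map_liftPathQuotient (FundamentalGroup.toPath β)
    (baseFiber θ t (n + 1))
  have hβ' := isCoveringMap_proj.map_liftPathQuotient (FundamentalGroup.toPath β')
    (baseFiber θ t (n + 1))
  have hΔ : (Path.Homotopic.Quotient.mk Δ).map proj =
      (FundamentalGroup.toPath β').cast (proj_endpoint θ t β) hp := by
    have h1 : (Path.Homotopic.Quotient.mk Γ').map proj =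
      (FundamentalGroup.toPath β').cast rfl (proj_endpoint θ t β') := by rw [hΓ']; exact hβ'
    have h2 : (Path.Homotopic.Quotient.mk Δ).map proj =
        ((Path.Homotopic.Quotient.mk Γ').map proj).cast (proj_endpoint θ t β) (proj_smul _ _) := by
      rw [← Path.Homotopic.Quotient.mk_map, ← Path.Homotopic.Quotient.mk_map,
        ← Path.Homotopic.Quotient.mk_cast]
      congr 1
      ext s
      exact proj_smul _ _
    rw [h2, h1, Path.Homotopic.Quotient.cast_cast]
  have hq : ∀ j, (τ⁻¹ • (endpoint θ t β').1).1 j =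
      (base θ t (n + 1)).1 ((strandPerm θ t β' * τ) j) := by
    intro j
    rw [smul_coe, inv_inv, endpoint_apply]
    rfl
  rw [removeStrand_eq_removeGeom θ t (β' * β)
    ((Path.Homotopic.Quotient.mk Γ).trans (Path.Homotopic.Quotient.mk Δ)) hp ?_
    (strandPerm θ t β' * τ) hq i]
  · have hE : proj (forget i (τ⁻¹ • (endpoint θ t β').1)) =
        proj (forget (τ i) (endpoint θ t β').1) :=
      proj_forget_eq (fun j => by rw [smul_coe, inv_inv]) i
    have key : ((Path.Homotopic.Quotient.mk Δ).map (forget i)).map proj =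
        (((Path.Homotopic.Quotient.mk Γ').map (forget (τ i))).map proj).cast
          (proj_forget_eq (endpoint_apply θ t β) i) hE := by
      rw [← Path.Homotopic.Quotient.mk_map, ← Path.Homotopic.Quotient.mk_map,
        ← Path.Homotopic.Quotient.mk_map, ← Path.Homotopic.Quotient.mk_map,
        ← Path.Homotopic.Quotient.mk_cast]
      congr 1
      ext s
      exact proj_forget_eq (x := Γ' s) (y := τ⁻¹ • Γ' s) (τ := τ)
        (fun j => by rw [smul_coe, inv_inv]) i
    rw [FundamentalGroup.mul_def]
    unfold removeStrand
    rw [← hΓ, ← hΓ']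
    unfold removeGeom
    refine Eq.trans ?_ (conj_trans (gapClass θ t i) _ (gapClass θ t (τ i)) _ _ _ hE _).symm
    rw [← key, map_trans, map_trans]
    rfl
  · rw [map_trans, hΔ, hΓ]
    exact (congrArg₂ _ hβ rfl).trans (cast_trans_cast _ _ _ _ _)

theorem removeStrand_one (i : Fin (n + 1)) :
    removeStrand θ t i (1 : BraidGroup θ t (n + 1)) = 1 := by
  rw [removeStrand_eq_removeGeom θ t 1 (Path.Homotopic.Quotient.refl _) rfl
    (by rw [Path.Homotopic.Quotient.cast_rfl_rfl]; rfl) 1 (fun _ => rfl) i]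
  unfold removeGeom
  have : ((Path.Homotopic.Quotient.refl (base θ t (n + 1))).map (forget i)).map proj =
    Path.Homotopic.Quotient.refl (proj (forget i (base θ t (n + 1)))) := rfl
  rw [this, Path.Homotopic.Quotient.refl_trans]
  exact Path.Homotopic.Quotient.trans_symm _

/-- The subgroup `Brun_n(M)` of Brunnian braids in `B_n(M)`: the braids that become trivial after
the removal of any one strand. As `B_0(M)` is trivial, every `1`-strand braid is Brunnian. -/
def Brun : (n : ℕ) → Subgroup (BraidGroup θ t n)
  | 0 => ⊤
  | n + 1 =>
    { carrier := {β | ∀ i : Fin (n + 1), removeStrand θ t i β = 1}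
      one_mem' := removeStrand_one θ t
      mul_mem' := fun {a b} ha hb i => by
        rw [removeStrand_mul, ha, hb, one_mul]
      inv_mem' := fun {a} ha i => by
        have h := removeStrand_mul θ t a a⁻¹ ((strandPerm θ t a)⁻¹ i)
        rw [inv_mul_cancel, removeStrand_one, ha, mul_one] at h
        have hi : strandPerm θ t a ((strandPerm θ t a)⁻¹ i) = i :=
          Equiv.apply_symm_apply (strandPerm θ t a) i
        rw [hi] at h
        exact h.symm }

theorem mem_brun_succ {β : BraidGroup θ t (n + 1)} :
    β ∈ Brun θ t (n + 1) ↔ ∀ i : Fin (n + 1), removeStrand θ t i β = 1 := Iff.rfl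

end Braid

end SurfaceBraid

end

noncomputable section

namespace SurfaceBraid

open Set Topology unitInterval
open Path.Homotopic.Quotient (mk)

/-! ### Classes of paths that factor through a map -/

section Factors

variable {X Y : Type*} [TopologicalSpace X] [TopologicalSpace Y]

/-! Since `B_1(M) = π₁(M)`, every 2-braid is Brunnian when `π₁(M)` is trivial. Conversely, removal
is a crossed homomorphism, `d_i(γβ) = d_{σ(i)}(γ) d_i(β)` with `σ` the permutation of `β`
(`removeStrand_mul`). Exchanging two points inside a disc gives a Brunnian `β` that swaps the
endpoints (`exists_mem_brun_strandPerm_eq_swap`). If `γβγ⁻¹` is Brunnian too, applying `d_0` to `γβ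
= (γβγ⁻¹)γ` gives `d_1(γ) = d_0(γ)` (`removeStrand_eq_of_normal`). Now push a loop at `p_0` off
`p_1` (`factors_inclCompl`) and let `γ` run `p_0` along it with `p_1` fixed. Then `d_0(γ) = 1`,
hence `d_1(γ) = 1`, and the loop is null-homotopic. Homotopies are handled through `Factors`: a
one-strand removal is trivial exactly when the remaining strand is homotopic to a path along `θ`
(`removeGeom_eq_one_iff`), because `[0, ∞)` is simply connected. -/

/-- A homotopy class of paths in `Y` that is the image of a class of paths in `X` under `f`. -/
def Factors (f : C(X, Y)) {x y : Y} (P : Path.Homotopic.Quotient x y) : Prop :=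
  ∃ (a b : X) (ha : x = f a) (hb : y = f b) (R : Path.Homotopic.Quotient a b),
    P = (R.map f).cast ha hb

variable {f : C(X, Y)} {x y z : Y}

/-- Injectivity of `f` forces the two lifts to meet at the same point of `X`. -/
theorem Factors.trans (hf : Function.Injective f) {P : Path.Homotopic.Quotient x y}
    {Q : Path.Homotopic.Quotient y z} (hP : Factors f P) (hQ : Factors f Q) :
    Factors f (P.trans Q) := by
  obtain ⟨a, b, rfl, rfl, R, rfl⟩ := hP
  obtain ⟨b', c, hb, rfl, S, rfl⟩ := hQ
  obtain rfl := hf hb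
  refine ⟨a, c, rfl, rfl, R.trans S, ?_⟩
  simp only [Path.Homotopic.Quotient.cast_rfl_rfl, map_trans]

theorem Factors.symm {P : Path.Homotopic.Quotient x y} (hP : Factors f P) :
    Factors f P.symm := by
  obtain ⟨a, b, rfl, rfl, R, rfl⟩ := hP
  refine ⟨b, a, rfl, rfl, R.symm, ?_⟩
  induction R using Path.Homotopic.Quotient.ind
  rfl

theorem factors_refl (a : X) : Factors f (Path.Homotopic.Quotient.refl (f a)) :=
  ⟨a, a, rfl, rfl, .refl a, rfl⟩

theorem Factors.cast {P : Path.Homotopic.Quotient x y} (hP : Factors f P) {x' y' : Y}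
    (hx : x' = x) (hy : y' = y) : Factors f (P.cast hx hy) := by
  subst hx hy
  rwa [Path.Homotopic.Quotient.cast_rfl_rfl]

/-- Both lifts have the same endpoints by injectivity, hence coincide. This replaces explicit
homotopies, with `X` either a disc or `[0, ∞)`. -/
theorem Factors.unique [SimplyConnectedSpace X] (hf : Function.Injective f)
    {P Q : Path.Homotopic.Quotient x y} (hP : Factors f P) (hQ : Factors f Q) : P = Q := by
  obtain ⟨a, b, rfl, rfl, R, rfl⟩ := hP
  obtain ⟨a', b', ha, hb, S, rfl⟩ := hQ
  obtain rfl := hf ha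
  obtain rfl := hf hb
  rw [Subsingleton.elim R S]

theorem factors_mk (γ : Path x y) {a b : X} (δ : Path a b) (h : ∀ s, γ s = f (δ s)) :
    Factors f (mk γ) := by
  refine ⟨a, b, by simpa using h 0, by simpa using h 1, mk δ, ?_⟩
  rw [← Path.Homotopic.Quotient.mk_map, ← Path.Homotopic.Quotient.mk_cast]
  congr 1
  ext s
  exact h s

/-- The embedding makes the pointwise lift continuous. A simple curve is only assumed injective, so
paths along it go through `factors_mk` with an explicit lift. -/
theorem factors_of_isEmbedding (hf : IsEmbedding f) (γ : Path x y) (h : ∀ s, γ s ∈ range f) :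
    Factors f (mk γ) := by
  let δ : I → X := fun s => hf.toHomeomorph.symm ⟨γ s, h s⟩
  have hδ : Continuous δ := hf.toHomeomorph.symm.continuous.comp (γ.continuous.subtype_mk h)
  refine factors_mk γ (⟨⟨δ, hδ⟩, rfl, rfl⟩ : Path (δ 0) (δ 1)) fun s => ?_
  exact congrArg Subtype.val (hf.toHomeomorph.apply_symm_apply ⟨γ s, h s⟩).symm

end Factors

/-! ### Convex sets without isolated directions -/

section Triangle

variable {E : Type*} [NormedAddCommGroup E] [NormedSpace ℝ E]

/-- A convex set in which any two points are completed by a third one to a proper triangle. -/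
structure IsFat (C : Set E) : Prop where
  convex : Convex ℝ C
  exists_not_collinear : ∀ x ∈ C, ∀ y ∈ C, x ≠ y → ∃ z ∈ C, ¬ Collinear ℝ {x, y, z}

theorem notMem_segment_of_not_collinear {x y z : E} (h : ¬ Collinear ℝ {x, y, z}) :
    y ∉ segment ℝ x z ∧ z ∉ segment ℝ y x ∧ x ∉ segment ℝ z y := by
  refine ⟨fun h' => h (mem_segment_iff_wbtw.1 h').collinear, fun h' => h ?_, fun h' => h ?_⟩
  · have := (mem_segment_iff_wbtw.1 h').collinear
    rwa [Set.pair_comm, Set.insert_comm] at this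
  · have := (mem_segment_iff_wbtw.1 h').collinear
    rwa [Set.insert_comm, Set.pair_comm] at this

/-- With `z` completing a triangle, move one point at a time along a side while the other rests at
the opposite vertex: `x` to `z`, `y` to `x`, `z` to `y`. -/
theorem IsFat.joinedIn_swap {C : Set E} (hC : IsFat C) {x y : E} (hx : x ∈ C) (hy : y ∈ C)
    (hxy : x ≠ y) : JoinedIn {w : E × E | w.1 ∈ C ∧ w.2 ∈ C ∧ w.1 ≠ w.2} (x, y) (y, x) := by
  obtain ⟨z, hz, hxyz⟩ := hC.exists_not_collinear x hx y hy hxy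
  obtain ⟨h1, h2, h3⟩ := notMem_segment_of_not_collinear hxyz
  have left : ∀ {p p' q : E}, p ∈ C → p' ∈ C → q ∈ C → q ∉ segment ℝ p p' →
      JoinedIn {w : E × E | w.1 ∈ C ∧ w.2 ∈ C ∧ w.1 ≠ w.2} (p, q) (p', q) := by
    intro p p' q hp hp' hq hs
    refine ((JoinedIn.of_segment_subset subset_rfl).map
      (f := fun w => (w, q)) (by fun_prop)).mono ?_
    rintro _ ⟨w, hw, rfl⟩
    exact ⟨hC.convex.segment_subset hp hp' hw, hq, fun h : w = q => hs (h ▸ hw)⟩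
  have right : ∀ {p p' q : E}, p ∈ C → p' ∈ C → q ∈ C → q ∉ segment ℝ p p' →
      JoinedIn {w : E × E | w.1 ∈ C ∧ w.2 ∈ C ∧ w.1 ≠ w.2} (q, p) (q, p') := by
    intro p p' q hp hp' hq hs
    refine ((JoinedIn.of_segment_subset subset_rfl).map
      (f := fun w => (q, w)) (by fun_prop)).mono ?_
    rintro _ ⟨w, hw, rfl⟩
    exact ⟨hq, hC.convex.segment_subset hp hp' hw, fun h : q = w => hs (h ▸ hw)⟩
  exact ((left hx hz hy h1).trans (right hy hx hz h2)).trans (left hz hy hx h3)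

/-- If the segment meets `p`, detour through the third vertex `z` of a triangle. A side at `z`
containing `p` would put all three vertices on one line. -/
theorem IsFat.joinedIn_diff {C : Set E} (hC : IsFat C) {x y p : E} (hx : x ∈ C) (hy : y ∈ C)
    (hxp : x ≠ p) (hyp : y ≠ p) : JoinedIn (C \ {p}) x y := by
  by_cases hp : p ∈ segment ℝ x y
  · have hxy : x ≠ y := by
      rintro rfl
      rw [segment_same] at hp
      exact hxp hp.symm
    obtain ⟨z, hz, hxyz⟩ := hC.exists_not_collinear x hx y hy hxy
    have hxpy := (mem_segment_iff_wbtw.1 hp).collinear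
    have key : ∀ {a b : E}, a ≠ p → Collinear ℝ {a, p, b} → ¬ Collinear ℝ {a, b, z} →
        p ∉ segment ℝ a z := by
      intro a b ha h1 h2 h3
      have h4 := (mem_segment_iff_wbtw.1 h3).collinear
      refine h2 ?_
      have hb : b ∈ line[ℝ, a, p] := by
        refine h1.mem_affineSpan_of_mem_of_ne (by simp) (by simp) (by simp) ha
      have hz' : z ∈ line[ℝ, a, p] := by
        refine h4.mem_affineSpan_of_mem_of_ne (by simp) (by simp) (by simp) ha
      exact collinear_triple_of_mem_affineSpan_pair (left_mem_affineSpan_pair ℝ a p) hb hz'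
    have hpx := key hxp hxpy hxyz
    have hpy := key (b := x) hyp
      (by rwa [Set.insert_comm, Set.pair_comm, Set.insert_comm] at hxpy)
      (by rwa [Set.insert_comm])
    refine (JoinedIn.of_segment_subset (y := z) ?_).trans (JoinedIn.of_segment_subset ?_)
    · exact subset_sdiff_singleton (hC.convex.segment_subset hx hz) hpx
    · rw [segment_symm]
      exact subset_sdiff_singleton (hC.convex.segment_subset hy hz) hpy
  · exact JoinedIn.of_segment_subset
      (subset_sdiff_singleton (hC.convex.segment_subset hx hy) hp)

theorem isFat_halfBall (c : EuclideanSpace ℝ (Fin 2)) (r : ℝ) :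
    IsFat ({x : EuclideanSpace ℝ (Fin 2) | 0 ≤ x 0} ∩ Metric.ball c r) where
  convex := (EuclideanHalfSpace.convex (n := 2)).inter (convex_ball c r)
  exists_not_collinear x hx y hy hxy := by
    -- The direction `e` is transverse to `y - x` and points into the half-plane, so `x + ε • e`
    -- works for small `ε > 0`.
    obtain ⟨e, he, hdet⟩ : ∃ e : EuclideanSpace ℝ (Fin 2), 0 ≤ e 0 ∧
        (y 0 - x 0) * e 1 - (y 1 - x 1) * e 0 ≠ 0 := by
      by_cases h : y 1 - x 1 = 0
      · refine ⟨!₂[0, 1], by simp, ?_⟩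
        have : y 0 - x 0 ≠ 0 := fun h0 => hxy <| by
          ext i
          fin_cases i
          · exact (sub_eq_zero.1 h0).symm
          · exact (sub_eq_zero.1 h).symm
        simpa using this
      · exact ⟨!₂[1, 0], by simp, by simpa using fun h' => h (by linarith)⟩
    have hcont : Filter.Tendsto (fun ε : ℝ => x + ε • e) (𝓝[>] 0) (𝓝 x) := by
      have : Continuous fun ε : ℝ => x + ε • e := by fun_prop
      simpa using (this.tendsto 0).mono_left nhdsWithin_le_nhds
    obtain ⟨ε, hε, hε0⟩ := ((hcont.eventually (Metric.isOpen_ball.mem_nhds hx.2)).and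
      (self_mem_nhdsWithin (s := Ioi (0 : ℝ)))).exists
    refine ⟨x + ε • e, ⟨?_, hε⟩, fun hcol => ?_⟩
    · have := hx.1
      have : 0 ≤ ε * e 0 := mul_nonneg (le_of_lt hε0) he
      simp only [mem_ofPred_eq, PiLp.add_apply, PiLp.smul_apply, smul_eq_mul] at *
      linarith
    · obtain ⟨v, hv⟩ := (collinear_iff_of_mem (p₀ := x) (by simp)).1 hcol
      obtain ⟨a, ha⟩ := hv y (by simp)
      obtain ⟨b, hb⟩ := hv (x + ε • e) (by simp)
      have ha' : ∀ i, y i - x i = a * v i := fun i => by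
        rw [ha]; simp
      have hb' : ∀ i, ε * e i = b * v i := fun i => by
        have := congrArg (fun w : EuclideanSpace ℝ (Fin 2) => w i) hb
        simp only [vadd_eq_add, PiLp.add_apply, PiLp.smul_apply, smul_eq_mul] at this
        linarith
      refine hdet ((mul_eq_zero.1 (?_ : ε * _ = 0)).resolve_left (ne_of_gt hε0))
      calc ε * ((y 0 - x 0) * e 1 - (y 1 - x 1) * e 0)
          = (y 0 - x 0) * (ε * e 1) - (y 1 - x 1) * (ε * e 0) := by ring
        _ = 0 := by rw [hb', hb', ha', ha']; ring

end Triangle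

/-! ### Surfaces -/

section Surface

variable {M : Type*} [TopologicalSpace M]

/-- A small ball cut with the half-plane treats interior and boundary points alike. -/
theorem exists_disc [ChartedSpace (EuclideanHalfSpace 2) M] (x : M) :
    ∃ (C : Set (EuclideanSpace ℝ (Fin 2))) (φ : C(C, M)),
      IsFat C ∧ IsOpenEmbedding φ ∧ x ∈ range φ := by
  let e := chartAt (EuclideanHalfSpace 2) x
  let v : EuclideanHalfSpace 2 → EuclideanSpace ℝ (Fin 2) := Subtype.val
  have hx : e x ∈ e.target := e.map_source (mem_chart_source _ x)
  obtain ⟨W, hW, hWe⟩ := isOpen_induced_iff.1 e.open_target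
  obtain ⟨r, hr, hrW⟩ := Metric.isOpen_iff.1 hW (v (e x)) (by rw [← hWe] at hx; exact hx)
  let C := {w : EuclideanSpace ℝ (Fin 2) | 0 ≤ w 0} ∩ Metric.ball (v (e x)) r
  have hmem : ∀ w : C, (⟨w.1, w.2.1⟩ : EuclideanHalfSpace 2) ∈ e.target := fun w => by
    rw [← hWe]
    exact hrW w.2.2
  let j : C → e.target := fun w => ⟨⟨w.1, w.2.1⟩, hmem w⟩
  have hvi : IsEmbedding (fun w : e.target => v w.1) :=
    IsEmbedding.subtypeVal.comp IsEmbedding.subtypeVal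
  have hji : IsEmbedding j := by
    refine IsEmbedding.of_comp ?_ hvi.continuous IsEmbedding.subtypeVal
    exact (continuous_subtype_val.subtype_mk _).subtype_mk _
  have hjo : IsOpenEmbedding j := by
    have hr : range j = (fun w : e.target => v w.1) ⁻¹' Metric.ball (v (e x)) r := by
      ext w
      constructor
      · rintro ⟨c, rfl⟩
        exact c.2.2
      · exact fun hw => ⟨⟨v w.1, w.1.2, hw⟩, rfl⟩
    exact ⟨hji, hr ▸ Metric.isOpen_ball.preimage hvi.continuous⟩
  have hφ : IsOpenEmbedding (e.symm.source.domRestrict e.symm ∘ j) :=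
    e.symm.isOpenEmbedding_restrict.comp hjo
  refine ⟨C, ⟨_, hφ.continuous⟩, isFat_halfBall _ _, hφ, ⟨v (e x), (e x).2, ?_⟩, ?_⟩
  · exact Metric.mem_ball_self hr
  · exact e.left_inv (mem_chart_source _ x)

/-- The inclusion of the complement of a point. -/
def inclCompl (p : M) : C({z : M // z ≠ p}, M) := ⟨Subtype.val, continuous_subtype_val⟩

/-- The disc is contractible, so the path may be replaced by any other path in the disc with the
same endpoints, in particular by one that avoids `p`. -/
theorem Factors.inclCompl_of_disc {E : Type*} [NormedAddCommGroup E] [NormedSpace ℝ E] {C : Set E}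
    (hC : IsFat C) {φ : C(C, M)} (hφ : IsOpenEmbedding φ) {p : M} (hp : p ∈ range φ) {x y : M}
    (hx : x ≠ p) (hy : y ≠ p) {P : Path.Homotopic.Quotient x y} (hP : Factors φ P) :
    Factors (inclCompl p) P := by
  obtain ⟨c, rfl⟩ := hp
  obtain ⟨a, b, rfl, rfl, R, hR⟩ := id hP
  have : ContractibleSpace C := hC.convex.contractibleSpace ⟨a, a.2⟩
  have hj : JoinedIn (C \ {c.1}) a.1 b.1 := hC.joinedIn_diff a.2 b.2
    (fun h => hx (congrArg φ (Subtype.ext h))) (fun h => hy (congrArg φ (Subtype.ext h)))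
  let δ : Path a b := ⟨⟨fun s => ⟨hj.somePath s, (hj.somePath_mem s).1⟩,
    hj.somePath.continuous.subtype_mk _⟩, Subtype.ext (by simp), Subtype.ext (by simp)⟩
  have h1 : Factors φ (mk (δ.map φ.continuous)) := factors_mk _ δ fun _ => rfl
  rw [hP.unique hφ.injective h1]
  refine factors_of_isEmbedding IsEmbedding.subtypeVal _ fun s => ⟨⟨φ (δ s), fun h => ?_⟩, rfl⟩
  exact (hj.somePath_mem s).2 (congrArg Subtype.val (hφ.injective h))

/-- General position: a path in a surface can be moved off a point other than its endpoints. -/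
theorem factors_inclCompl [T1Space M] [ChartedSpace (EuclideanHalfSpace 2) M] {x y p : M}
    (hx : x ≠ p) (hy : y ≠ p) (P : Path.Homotopic.Quotient x y) : Factors (inclCompl p) P := by
  obtain ⟨γ, rfl⟩ := Path.Homotopic.Quotient.mk_surjective P
  obtain ⟨C, φ, hC, hφ, hp⟩ := exists_disc p
  have hi : Function.Injective (inclCompl p) := Subtype.val_injective
  -- The invariant allows a pending last piece inside the disc, since a subdivision point may be `p`
  -- itself.
  let good : ∀ {a b : M}, Path.Homotopic.Quotient a b → Prop := fun {a b} Q =>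
    Factors (inclCompl p) Q ∨ ∃ z, z ≠ p ∧ ∃ (A : Path.Homotopic.Quotient a z)
      (B : Path.Homotopic.Quotient z b), Factors (inclCompl p) A ∧ Factors φ B ∧ Q = A.trans B
  have fin : ∀ {a b : M} {Q : Path.Homotopic.Quotient a b}, b ≠ p → good Q →
      Factors (inclCompl p) Q := by
    rintro a b Q hb (h | ⟨z, hz, A, B, hA, hB, rfl⟩)
    · exact h
    · exact hA.trans hi (hB.inclCompl_of_disc hC hφ hp hz hb)
  -- Each piece of the subdivision lies in the disc (`true`) or misses `p` (`false`).
  obtain ⟨t, ht0, htm, ⟨N, hN⟩, hc⟩ := exists_monotone_Icc_subset_open_cover_unitInterval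
    (c := fun b : Bool => γ ⁻¹' (if b then range φ else {p}ᶜ)) (fun b => by
      cases b
      · exact isOpen_compl_singleton.preimage γ.continuous
      · exact hφ.isOpen_range.preimage γ.continuous) (fun s _ => by
      by_cases hs : γ s = p
      · exact mem_iUnion.2 ⟨true, by simpa [hs] using hp⟩
      · exact mem_iUnion.2 ⟨false, by simpa using hs⟩)
  have step : ∀ n, good (mk (γ.subpath 0 (t n))) := by
    intro n
    induction n with
    | zero =>
      left
      rw [ht0, Path.subpath_self]
      exact factors_refl (f := inclCompl p) ⟨γ 0, by simpa using hx⟩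
    | succ n ih =>
      have hsub : mk (γ.subpath 0 (t (n + 1))) =
          (mk (γ.subpath 0 (t n))).trans (mk (γ.subpath (t n) (t (n + 1)))) :=
        (Path.Homotopic.Quotient.eq.2 ⟨Path.Homotopy.subpathTransSubpath γ _ _ _⟩).symm
      obtain ⟨b, hb⟩ := hc n
      have hb' : ∀ s, γ.subpath (t n) (t (n + 1)) s ∈ (if b then range φ else {p}ᶜ) := by
        intro s
        have := mem_range_self (f := γ.subpath (t n) (t (n + 1))) s
        rw [Path.range_subpath_of_le _ _ _ (htm n.le_succ)] at this
        obtain ⟨u, hu, hus⟩ := this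
        rw [← hus]
        exact hb hu
      rw [hsub]
      cases b
      -- The new piece starts off `p`, so the pending disc piece can be pushed off `p` first.
      · have hne : γ (t n) ≠ p := by simpa using hb' 0
        left
        refine (fin hne ih).trans hi (factors_of_isEmbedding IsEmbedding.subtypeVal _ fun s => ?_)
        exact ⟨⟨_, hb' s⟩, rfl⟩
      · have hφs : Factors φ (mk (γ.subpath (t n) (t (n + 1)))) :=
          factors_of_isEmbedding hφ.isEmbedding _ hb'
        rcases ih with h | ⟨z, hz, A, B, hA, hB, h⟩
        · by_cases hn : γ (t n) = p
          · obtain ⟨a, b, ha, hb, R, -⟩ := h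
            exact absurd hn (hb ▸ b.2)
          · exact Or.inr ⟨_, hn, _, _, h, hφs, rfl⟩
        · refine Or.inr ⟨z, hz, A, _, hA, hB.trans hφ.injective hφs, ?_⟩
          rw [h, Path.Homotopic.Quotient.trans_assoc]
  have h1 := step N
  rw [hN N le_rfl, Path.subpath_zero_one] at h1
  simpa using (fin (by simpa using hy) h1).cast γ.source.symm γ.target.symm

end Surface

/-! ### One-point configurations -/

section OnePoint

variable {M : Type*} [TopologicalSpace M]

/-- The `i`-th point of a configuration. -/
def coord {n : ℕ} (i : Fin n) : C(Conf M n, M) :=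
  ⟨fun x => x.1 i, (continuous_apply i).comp continuous_subtype_val⟩

/-- An unordered configuration of one point is a point. -/
def pointHomeomorph : UConf M 1 ≃ₜ M where
  toFun := Quotient.lift (fun x : Conf M 1 => x.1 0) fun x y h => by
    obtain ⟨g, rfl⟩ := MulAction.orbitRel_apply.1 h
    exact congrArg y.1 (Subsingleton.elim _ _)
  invFun x := proj ⟨fun _ => x, fun _ _ _ => Subsingleton.elim _ _⟩
  left_inv u := by
    induction u using Quotient.inductionOn with | h x =>
    refine congrArg proj (Subtype.ext (funext fun i => ?_))
    exact congrArg x.1 (Subsingleton.elim _ _)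
  right_inv _ := rfl
  continuous_toFun := (coord (M := M) (0 : Fin 1)).continuous.quotient_lift _
  continuous_invFun := proj.continuous.comp
    (Continuous.subtype_mk (continuous_pi fun _ => continuous_id) _)

/-- The point of an unordered configuration of one point. -/
def point : C(UConf M 1, M) := ⟨pointHomeomorph, pointHomeomorph.continuous⟩

theorem map_injective_of_leftInverse {X Y : Type*} [TopologicalSpace X] [TopologicalSpace Y]
    {f : C(X, Y)} {g : C(Y, X)} (h : Function.LeftInverse g f) (a b : X) :
    Function.Injective fun P : Path.Homotopic.Quotient a b => P.map f := by
  intro P Q hPQ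
  induction P using Path.Homotopic.Quotient.ind with | mk P =>
  induction Q using Path.Homotopic.Quotient.ind with | mk Q =>
  have hfg := ((Path.Homotopic.Quotient.eq.1 hPQ).map g).pathCast (h a).symm (h b).symm
  have key : ∀ R : Path a b, ((R.map f.continuous).map g.continuous).cast (h a).symm (h b).symm =
      R := fun R => Path.ext (funext fun s => h (R s))
  rw [key, key] at hfg
  exact Path.Homotopic.Quotient.eq.2 hfg

theorem map_point_injective (a b : UConf M 1) :
    Function.Injective fun P : Path.Homotopic.Quotient a b => P.map point :=
  map_injective_of_leftInverse (f := point) (g := ⟨_, pointHomeomorph.symm.continuous⟩)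
    pointHomeomorph.left_inv a b

theorem map_proj_map_point {x y : Conf M 1} (P : Path.Homotopic.Quotient x y) :
    (P.map proj).map point = P.map (coord 0) := by
  rw [← Path.Homotopic.Quotient.map_comp]
  rfl

theorem map_symm_cast {X Y : Type*} [TopologicalSpace X] [TopologicalSpace Y] {a b b' : X}
    (P : Path.Homotopic.Quotient a b) (h : b' = b) (f : C(X, Y)) :
    (P.symm.cast h rfl).map f = (P.map f).symm.cast (congrArg f h) rfl := by
  subst h
  induction P using Path.Homotopic.Quotient.ind
  rfl

end OnePoint

/-! ### Removing a strand from a two-strand braid, and the elementary braid -/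

section Removal

variable {M : Type*} [TopologicalSpace M] (θ : SimpleCurve M) (t : ℕ ↪o ℝ≥0)

/-- A simple curve as a bundled continuous map. -/
def curveMap : C(ℝ≥0, M) := ⟨θ.toFun, θ.continuous_toFun⟩

theorem simplyConnectedSpace_nnreal : SimplyConnectedSpace ℝ≥0 := by
  have : ContractibleSpace ℝ≥0 := (convex_Ici (0 : ℝ)).contractibleSpace ⟨0, self_mem_Ici⟩
  infer_instance

/-- The straight path between two non-negative reals. -/
def linePath (a b : ℝ≥0) : Path a b where
  toFun s := unitInterval.toNNReal (unitInterval.symm s) * a + unitInterval.toNNReal s * b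
  continuous_toFun := by
    have h1 := unitInterval.toNNReal_continuous
    exact ((h1.comp unitInterval.continuous_symm).mul continuous_const).add
      (h1.mul continuous_const)
  source' := by simp
  target' := by simp

theorem linePath_mem_Icc {a b l u : ℝ≥0} (ha : a ∈ Icc l u) (hb : b ∈ Icc l u) (s : I) :
    linePath a b s ∈ Icc l u := by
  refine convex_Icc (𝕜 := ℝ≥0) l u ha hb (zero_le (a := (_ : ℝ≥0))) (zero_le (a := (_ : ℝ≥0))) ?_
  apply NNReal.coe_injective
  simp

theorem factors_linearBraid {n : ℕ} {a b : Fin n → ℝ≥0} (ha : StrictMono a) (hb : StrictMono b)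
    {x y : Conf M n} (hx : ∀ j, x.1 j = θ.toFun (a j)) (hy : ∀ j, y.1 j = θ.toFun (b j))
    (i : Fin n) :
    Factors (curveMap θ) ((mk (linearBraid θ ha hb hx hy)).map (coord i)) :=
  factors_mk ((linearBraid θ ha hb hx hy).map (coord i).continuous) (linePath (a i) (b i))
    fun _ => rfl

theorem factors_gapClass (i : Fin 2) : Factors (curveMap θ) ((gapClass θ t i).map point) := by
  unfold gapClass
  rw [map_proj_map_point]
  exact factors_linearBraid ..

/-- A loop along the curve is trivial because `[0, ∞)` is simply connected; conversely, a trivial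
product gives `P = L⁻¹ L'`. -/
theorem trans_symm_eq_refl_iff_factors {o a b b' : M} {L : Path.Homotopic.Quotient o a}
    {P : Path.Homotopic.Quotient a b} {L' : Path.Homotopic.Quotient o b'}
    (hL : Factors (curveMap θ) L) (hL' : Factors (curveMap θ) L') (h : b = b') :
    L.trans (P.trans (L'.symm.cast h rfl)) = .refl o ↔ Factors (curveMap θ) P := by
  have := simplyConnectedSpace_nnreal
  have hi : Function.Injective (curveMap θ) := θ.injective_toFun
  subst h
  rw [Path.Homotopic.Quotient.cast_rfl_rfl]
  constructor
  · intro h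
    have h1 : P = L.symm.trans ((L.trans (P.trans L'.symm)).trans L') := by
      simp [← Path.Homotopic.Quotient.trans_assoc]
      simp [Path.Homotopic.Quotient.trans_assoc]
    rw [h1, h, Path.Homotopic.Quotient.refl_trans]
    exact hL.symm.trans hi hL'
  · intro h
    refine Factors.unique hi (hL.trans hi (h.trans hi hL'.symm)) ?_
    obtain ⟨a, -, rfl, -⟩ := hL
    exact factors_refl a

/-- Removing one of two strands yields the trivial braid if and only if the remaining strand is
homotopic to a path along the curve. -/
theorem removeGeom_eq_one_iff {q : Conf M 2} (Γ : Path.Homotopic.Quotient (base θ t 2) q)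
    (τ : Equiv.Perm (Fin 2)) (hq : ∀ j, q.1 j = (base θ t 2).1 (τ j)) (i : Fin 2) :
    removeGeom θ t Γ τ hq i = 1 ↔ Factors (curveMap θ) (Γ.map (coord (i.succAbove 0))) := by
  -- With two strands, `i.succAbove 0` is the index other than `i`.
  have h1 : (((Γ.map (forget i)).map proj).map point) = Γ.map (coord (i.succAbove 0)) := by
    rw [map_proj_map_point, ← Path.Homotopic.Quotient.map_comp]
    rfl
  refine Iff.trans ?_ ((trans_symm_eq_refl_iff_factors θ (factors_gapClass θ t i)
    (factors_gapClass θ t (τ i)) (congrArg point (proj_forget_eq hq i))).trans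
    (iff_of_eq (congrArg (Factors (curveMap θ)) h1)))
  rw [← map_symm_cast, ← map_trans, ← map_trans]
  exact (map_point_injective _ _).eq_iff.symm

/-- Two distinct points in a disc can be exchanged within the disc. -/
theorem exists_swap_path {E : Type*} [NormedAddCommGroup E] [NormedSpace ℝ E] {C : Set E}
    (hC : IsFat C) {φ : C(C, M)} (hφ : IsOpenEmbedding φ) (x : Conf M 2)
    (hx : ∀ j, x.1 j ∈ range φ) :
    ∃ Γ : Path x (Equiv.swap (0 : Fin 2) 1 • x), ∀ s j, (Γ s).1 j ∈ range φ := by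
  obtain ⟨a, ha⟩ := hx 0
  obtain ⟨b, hb⟩ := hx 1
  have hab : a.1 ≠ b.1 := fun h => zero_ne_one (x.2 (by rw [← ha, ← hb, Subtype.ext h]))
  have hj := hC.joinedIn_swap a.2 b.2 hab
  have hm := hj.somePath_mem
  let u : I → C := fun s => ⟨(hj.somePath s).1, (hm s).1⟩
  let v : I → C := fun s => ⟨(hj.somePath s).2, (hm s).2.1⟩
  have hu : Continuous u := (continuous_fst.comp hj.somePath.continuous).subtype_mk _
  have hv : Continuous v := (continuous_snd.comp hj.somePath.continuous).subtype_mk _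
  have huv : ∀ s, φ (u s) ≠ φ (v s) := fun s h =>
    (hm s).2.2 (congrArg Subtype.val (hφ.injective h))
  have hu0 : u 0 = a := Subtype.ext (by simp [u])
  have hv0 : v 0 = b := Subtype.ext (by simp [v])
  have hu1 : u 1 = b := Subtype.ext (by simp [u])
  have hv1 : v 1 = a := Subtype.ext (by simp [v])
  refine ⟨⟨⟨fun s => ⟨![φ (u s), φ (v s)], ?_⟩, ?_⟩, ?_, ?_⟩, fun s j => ?_⟩
  · intro i j h
    fin_cases i <;> fin_cases j <;> first | rfl | exact absurd h (huv s) |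
      exact absurd h.symm (huv s)
  · refine Continuous.subtype_mk (continuous_pi fun j => ?_) _
    fin_cases j
    · exact φ.continuous.comp hu
    · exact φ.continuous.comp hv
  · apply Subtype.ext
    funext j
    fin_cases j
    · exact (congrArg φ hu0).trans ha
    · exact (congrArg φ hv0).trans hb
  · apply Subtype.ext
    funext j
    rw [smul_coe, Equiv.swap_inv]
    fin_cases j
    · exact (congrArg φ hu1).trans hb
    · exact (congrArg φ hv1).trans ha
  · fin_cases j
    · exact mem_range_self (u s)
    · exact mem_range_self (v s)

variable [T2Space M]

/-- Lifts from the base point are unique up to homotopy, so any of them determines the permutation.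
-/
theorem strandPerm_eq {n : ℕ} (β : BraidGroup θ t n) {q : Conf M n}
    (Γ : Path.Homotopic.Quotient (base θ t n) q) (hp : proj q = proj (base θ t n))
    (hΓ : Γ.map proj = (FundamentalGroup.toPath β).cast rfl hp)
    (τ : Equiv.Perm (Fin n)) (hq : ∀ j, q.1 j = (base θ t n).1 (τ j)) :
    strandPerm θ t β = τ := by
  have h1 : (endpoint θ t β).1 = q :=
    congrArg Subtype.val (isCoveringMap_proj.monodromy_eq_of_map_eq
      (γ := FundamentalGroup.toPath β) (ex := baseFiber θ t n) (ey := ⟨q, hp⟩) Γ hΓ)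
  subst h1
  ext1 j
  exact (base θ t n).2 ((endpoint_apply θ t β j).symm.trans (hq j))

/-- The two-strand braid with a given lift. -/
theorem exists_braid {q : Conf M 2} (Γ : Path.Homotopic.Quotient (base θ t 2) q)
    (τ : Equiv.Perm (Fin 2)) (hq : ∀ j, q.1 j = (base θ t 2).1 (τ j)) :
    ∃ β : BraidGroup θ t 2, strandPerm θ t β = τ ∧ ∀ i : Fin 2,
      (removeStrand θ t i β = 1 ↔ Factors (curveMap θ) (Γ.map (coord (i.succAbove 0)))) := by
  have hp : proj q = proj (base θ t 2) := by
    apply proj_eq_of_range_eq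
    rw [show q.1 = (base θ t 2).1 ∘ τ from funext hq, τ.surjective.range_comp]
  let β : BraidGroup θ t 2 := FundamentalGroup.fromPath ((Γ.map proj).cast rfl hp.symm)
  have hΓ : Γ.map proj = (FundamentalGroup.toPath β).cast rfl hp := by
    change _ = ((Γ.map proj).cast rfl hp.symm).cast rfl hp
    rw [Path.Homotopic.Quotient.cast_cast, Path.Homotopic.Quotient.cast_rfl_rfl]
  refine ⟨β, strandPerm_eq θ t β Γ hp hΓ τ hq, fun i => ?_⟩
  rw [removeStrand_eq_removeGeom θ t β Γ hp hΓ τ hq i, removeGeom_eq_one_iff]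

/-- The elementary braid: a Brunnian two-strand braid that exchanges its endpoints. -/
theorem exists_mem_brun_strandPerm_eq_swap [ChartedSpace (EuclideanHalfSpace 2) M] :
    ∃ β ∈ Brun θ t 2, strandPerm θ t β = Equiv.swap 0 1 := by
  obtain ⟨C, φ, hC, hφ, h0⟩ := exists_disc (θ.toFun (t 0))
  have hi : Function.Injective (curveMap θ) := θ.injective_toFun
  -- The disc about `p_0` need not contain `p_1`, so the second point is first slid along the curve
  -- to `θ b`, with the arc over `[t 0, b]` in the disc.
  obtain ⟨b, htb, hb⟩ : ∃ b, t 0 < b ∧ ∀ s ∈ Icc (t 0) b, θ.toFun s ∈ range φ := by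
    have hn : θ.toFun ⁻¹' range φ ∈ 𝓝 (t 0) :=
      (hφ.isOpen_range.preimage θ.continuous_toFun).mem_nhds h0
    obtain ⟨l, hl, hlm⟩ := exists_Ico_subset_of_mem_nhds hn ⟨t 0 + 1, by simp⟩
    obtain ⟨b, h1, h2⟩ := exists_between hl
    exact ⟨b, h1, fun s hs => hlm ⟨hs.1, hs.2.trans_lt h2⟩⟩
  let a : Fin 2 → ℝ≥0 := ![t 0, b]
  have ha : StrictMono a := by
    intro i j hij
    fin_cases i <;> fin_cases j <;> first | exact absurd hij (by decide) | exact htb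
  have ht : StrictMono fun j : Fin 2 => t j := fun _ _ h => t.strictMono h
  let x : Conf M 2 := ⟨fun j => θ.toFun (a j), θ.injective_toFun.comp ha.injective⟩
  have haI : ∀ j, a j ∈ Icc (t 0) b := by
    intro j
    fin_cases j
    · exact ⟨le_rfl, htb.le⟩
    · exact ⟨htb.le, le_rfl⟩
  obtain ⟨Γ, hΓ⟩ := exists_swap_path hC hφ x fun j => hb _ (haI j)
  let g : Equiv.Perm (Fin 2) := Equiv.swap 0 1
  let act : C(Conf M 2, Conf M 2) :=
    ⟨fun x => g • x, isQuotientCoveringMap_proj.continuous_const_smul g⟩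
  let L : Path (base θ t 2) x := linearBraid θ ht ha (fun _ => rfl) fun _ => rfl
  let L' : Path x (base θ t 2) := linearBraid θ ha ht (fun _ => rfl) fun _ => rfl
  -- Slide in, exchange, slide back with the labels permuted by `g`.
  obtain ⟨β, hβ, hβ'⟩ := exists_braid θ t (q := g • base θ t 2)
    (((mk L).trans (mk Γ)).trans ((mk L').map act)) g fun j => by
      rw [smul_coe, Equiv.swap_inv]
  refine ⟨β, fun i => (hβ' i).2 ?_, hβ⟩
  generalize i.succAbove 0 = k
  rw [map_trans, map_trans]
  have h1 : Factors (curveMap θ) ((mk L).map (coord k)) := factors_linearBraid ..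
  have h2 : Factors (curveMap θ) (((mk L').map act).map (coord k)) := by
    rw [← Path.Homotopic.Quotient.map_comp]
    exact factors_linearBraid θ ha ht (fun _ => rfl) (fun _ => rfl) (g⁻¹ k)
  refine (h1.trans hi ?_).trans hi h2
  -- Each strand of the exchange shares its endpoints with an arc of the curve in the same disc, so
  -- the two are homotopic.
  have h3 : Factors φ ((mk Γ).map (coord k)) :=
    factors_of_isEmbedding hφ.isEmbedding (Γ.map (coord k).continuous) fun s => hΓ s k
  have h4 : Factors φ (mk ((linePath (a k) (a (g⁻¹ k))).map (curveMap θ).continuous)) :=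
    factors_of_isEmbedding hφ.isEmbedding _ fun s => hb _ (linePath_mem_Icc (haI _) (haI _) s)
  have : ContractibleSpace C := hC.convex.contractibleSpace (by
    obtain ⟨c, -⟩ := h0
    exact ⟨c, c.2⟩)
  exact Factors.unique hφ.injective h3 h4 ▸ factors_mk _ (linePath _ _) fun _ => rfl

end Removal


/-! ### Normality of the group of two-strand Brunnian braids -/

section Main

variable {M : Type*} [TopologicalSpace M] [T2Space M] (θ : SimpleCurve M) (t : ℕ ↪o ℝ≥0)

theorem brun_two_eq_top (h : ∀ x : M, Subsingleton (FundamentalGroup M x)) :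
    Brun θ t 2 = ⊤ := by
  refine eq_top_iff.2 fun β _ => (mem_brun_succ θ t).2 fun i => ?_
  exact map_point_injective _ _ ((h _).elim _ _)

/-- If the Brunnian braids form a normal subgroup, removing either strand of a two-strand braid
yields the same result. -/
theorem removeStrand_eq_of_normal [ChartedSpace (EuclideanHalfSpace 2) M]
    (h : (Brun θ t 2).Normal) (γ : BraidGroup θ t 2) :
    removeStrand θ t 1 γ = removeStrand θ t 0 γ := by
  obtain ⟨β, hβ, hs⟩ := exists_mem_brun_strandPerm_eq_swap θ t
  -- Expand `d_0` of `(γβγ⁻¹)γ = γβ` in both ways.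
  have h1 := removeStrand_mul θ t γ (γ * β * γ⁻¹) 0
  rw [(mem_brun_succ θ t).1 (h.conj_mem β hβ γ), one_mul, inv_mul_cancel_right,
    removeStrand_mul, (mem_brun_succ θ t).1 hβ, mul_one, hs, Equiv.swap_apply_left] at h1
  exact h1

theorem subsingleton_fundamentalGroup_base [ChartedSpace (EuclideanHalfSpace 2) M]
    (h : (Brun θ t 2).Normal) : Subsingleton (FundamentalGroup M (θ.toFun (t 0))) := by
  have := simplyConnectedSpace_nnreal
  have hi : Function.Injective (curveMap θ) := θ.injective_toFun
  have hne : θ.toFun (t 0) ≠ θ.toFun (t 1) := fun h =>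
    zero_ne_one (t.injective (θ.injective_toFun h))
  -- Two loops along the curve with the same base point are homotopic.
  suffices H : ∀ P : Path.Homotopic.Quotient (θ.toFun (t 0)) (θ.toFun (t 0)),
      Factors (curveMap θ) P from ⟨fun P Q => (H P).unique hi (H Q)⟩
  intro P
  obtain ⟨⟨a, ha⟩, ⟨a', ha'⟩, h0, h1, R, rfl⟩ := factors_inclCompl hne hne P
  obtain rfl : a = _ := h0.symm
  obtain rfl : a' = _ := h1.symm
  obtain ⟨ρ, rfl⟩ := Path.Homotopic.Quotient.mk_surjective R
  let f : C({z : M // z ≠ θ.toFun (t 1)}, Conf M 2) :=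
    ⟨fun z => ⟨![z.1, θ.toFun (t 1)], by
      intro i j hij
      fin_cases i <;> fin_cases j <;> first | rfl | exact absurd hij z.2 |
        exact absurd hij.symm z.2⟩, by
      refine Continuous.subtype_mk (continuous_pi fun j => ?_) _
      fin_cases j
      · exact continuous_subtype_val
      · exact continuous_const⟩
  have hf : base θ t 2 = f ⟨θ.toFun (t 0), ha⟩ := by
    apply Subtype.ext
    funext j
    fin_cases j <;> rfl
  let Γ : Path (base θ t 2) (base θ t 2) := (ρ.map f.continuous).cast hf hf
  obtain ⟨γ, -, hγ⟩ := exists_braid θ t (mk Γ) 1 fun _ => rfl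
  -- Only the constant strand at `p_1` remains.
  have h2 : removeStrand θ t 0 γ = 1 :=
    (hγ 0).2 (factors_mk (Γ.map (coord 1).continuous) (Path.refl (t 1)) fun _ => rfl)
  exact (hγ 1).1 ((removeStrand_eq_of_normal θ t h γ).trans h2)

end Main

end SurfaceBraid

end

theorem mainTheorem10 {M : Type*} [TopologicalSpace M] [T2Space M] [ConnectedSpace M]
    [ChartedSpace (EuclideanHalfSpace 2) M] (θ : SurfaceBraid.SimpleCurve M) (t : ℕ ↪o NNReal) :
    (SurfaceBraid.Brun θ t 2).Normal ↔ ∀ x : M, Subsingleton (FundamentalGroup M x) := by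
  constructor
  · intro h x
    have := SurfaceBraid.subsingleton_fundamentalGroup_base θ t h
    -- A connected surface is path connected, which moves the base point from `p_0` to `x`.
    have := ChartedSpace.locallyPathConnectedSpace (EuclideanHalfSpace 2) M
    have : PathConnectedSpace M := pathConnectedSpace_iff_connectedSpace.2 inferInstance
    exact (FundamentalGroup.fundamentalGroupMulEquivOfPathConnected x
      (θ.toFun (t 0))).toEquiv.subsingleton
  · intro h
    rw [SurfaceBraid.brun_two_eq_top θ t h]
    infer_instance
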